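/- **Theorem 1.** For $(u,v)\in\mathbb R^2$ let $$C(u,v)=\tfrac{\sqrt2}{2}\big(\cos(-u+v),\sin(-u+v),\cos(u+v),\sin(u+v)\big),\qquad N(u,v)=\tfrac{\sqrt2}{2}\big(\cos(-u+v),\sin(-u+v),-\cos(u+v),-\sin(u+v)\big)$$ be the parametrization of the Clifford torus in $\mathbb S^3\subset\mathbb R^4$ and its unit normal in $\mathbb S^3$, let $h(u,v)=\sin^2(2v-2u)$, and for $\varepsilon\in\mathbb R$ put $$\alpha_\varepsilon(u,v)=\frac{C(u,v)+\varepsilon\,h(u,v)N(u,v)}{|C(u,v)+\varepsilon\,h(u,v)N(u,v)|}.$$ Let $\mathbb T^2=\mathbb S^1\times\mathbb S^1$. For every $\delta>0$ there are an $\varepsilon\neq0$ with $|\varepsilon|<\delta$ and a $C^\infty$ embedding $\alpha:\mathbb T^2\to\mathbb S^3$ with $\alpha\big(e^{i(-u+v)},e^{i(u+v)}\big)=\alpha_\varepsilon(u,v)$ for all $u,v$, such that the following hold. 1. Every point of $\mathbb T^2$ is hyperbolic for $\alpha$, that is, the extrinsic Gaussian curvature $\det(DN_\alpha)$, where $N_\alpha$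 is the unit normal of $\alpha$ in $\mathbb S^3$, is negative everywhere. 2. Let $\mathcal A_{\alpha,1},\mathcal A_{\alpha,2}$ be the two asymptotic foliations, i.e. the integral foliations of the two line fields on which the second fundamental form of $\alpha$ in $\mathbb S^3$ vanishes. Then for $i=1,2$ a leaf of $\mathcal A_{\alpha,i}$, parametrized by arc length on all of $\mathbb R$, passes through every point of $\mathbb T^2$, and every leaf $\gamma$ of $\mathcal A_{\alpha,i}$ is dense in $\mathbb T^2$; moreover $L(\gamma)=\mathbb T^2$, where the limit set $L(\gamma)$ is the union of the $\alpha$-limit set and the $\omega$-limit set of $\gamma$. -/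

import Mathlib

open scoped Manifold ContDiff
open Filter Topology

noncomputable section

/-- Euclidean space `ℝ⁴` with its canonical inner product. -/
abbrev E4 : Type := EuclideanSpace ℝ (Fin 4)

/-- The unit sphere `S³` of `ℝ⁴`. -/
abbrev S3 : Type := Metric.sphere (0 : E4) 1

/-- The torus `T² = S¹ × S¹`. -/
abbrev Torus : Type := Circle × Circle

/-- A smooth (`C^∞`) embedding of the torus in `S³`: a smooth map with injective differential
at every point that is a homeomorphism onto its image. -/
structure IsTorusEmbedding (α : Torus → S3) : Prop where
  smooth : ContMDiff ((𝓡 1).prod (𝓡 1)) (𝓡 3) ∞ α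
  immersion : ∀ p, Function.Injective (mfderiv ((𝓡 1).prod (𝓡 1)) (𝓡 3) α p)
  embedding : IsEmbedding α

/-- The universal covering `ℝ² → T²`, `(x, y) ↦ (e^{ix}, e^{iy})`. Its restrictions to small open
sets are the inverses of (oriented) charts of the torus. -/
def cover (q : ℝ × ℝ) : Torus := (Circle.exp q.1, Circle.exp q.2)

namespace TorusMap

variable (α : Torus → S3)

/-- The map `α` in the coordinates `(x, y)`, with values in `ℝ⁴`. -/
def coord (x y : ℝ) : E4 := (α (cover (x, y)) : E4)

/-- Partial derivatives of `α` in the coordinates `(x, y)`. -/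
def dx (x y : ℝ) : E4 := deriv (fun s => coord α s y) x
def dy (x y : ℝ) : E4 := deriv (fun s => coord α x s) y
def dxx (x y : ℝ) : E4 := deriv (fun s => dx α s y) x
def dxy (x y : ℝ) : E4 := deriv (fun s => dx α x s) y
def dyy (x y : ℝ) : E4 := deriv (fun s => dy α x s) y

/-- Coefficients of the first fundamental form. -/
def formE (q : ℝ × ℝ) : ℝ := inner ℝ (dx α q.1 q.2) (dx α q.1 q.2)
def formF (q : ℝ × ℝ) : ℝ := inner ℝ (dx α q.1 q.2) (dy α q.1 q.2)
def formG (q : ℝ × ℝ) : ℝ := inner ℝ (dy α q.1 q.2) (dy α q.1 q.2)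

/-- The determinant of four vectors of `ℝ⁴`. -/
def det4 (a b c d : E4) : ℝ := Matrix.det (Matrix.of fun i j : Fin 4 => (![a, b, c, d] i) j)

/-- The normal component of `w`: the inner product of `w` with the unit normal
`α ∧ α_x ∧ α_y / |α ∧ α_x ∧ α_y|` of `α` in `S³`. -/
def normalPart (q : ℝ × ℝ) (w : E4) : ℝ :=
  det4 (coord α q.1 q.2) (dx α q.1 q.2) (dy α q.1 q.2) w /
    √(formE α q * formG α q - formF α q ^ 2)

/-- Coefficients of the second fundamental form `II = e dx² + 2 f dx dy + g dy²`. -/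
def forme (q : ℝ × ℝ) : ℝ := normalPart α q (dxx α q.1 q.2)
def formf (q : ℝ × ℝ) : ℝ := normalPart α q (dxy α q.1 q.2)
def formg (q : ℝ × ℝ) : ℝ := normalPart α q (dyy α q.1 q.2)

/-- The second fundamental form on the tangent vector `w`. -/
def secondForm (q w : ℝ × ℝ) : ℝ :=
  forme α q * w.1 ^ 2 + 2 * formf α q * w.1 * w.2 + formg α q * w.2 ^ 2

/-- The extrinsic Gaussian curvature. -/
def curvExt (q : ℝ × ℝ) : ℝ :=
  (forme α q * formg α q - formf α q ^ 2) / (formE α q * formG α q - formF α q ^ 2)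

/-- The point of the torus with coordinates `q` lies in the hyperbolic region. -/
def IsHyperbolic (q : ℝ × ℝ) : Prop := curvExt α q < 0

/-- The square root of the discriminant of `II`. -/
def disc (q : ℝ × ℝ) : ℝ := √(formf α q ^ 2 - forme α q * formg α q)

/-- The sign that distinguishes the two asymptotic line fields. -/
def lineSign (i : Fin 2) : ℝ := ![-1, 1] i

/-- The two asymptotic line fields on the hyperbolic region, `i = 0` being the first one and
`i = 1` the second one. With `D = √(f² - e g) > 0` and `σ = ∓1`, the two one-forms
`e dx + (f + σ D) dy` and `(f - σ D) dx + g dy` are proportional and do not both vanish; their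
common kernel is the line. The lines for `σ = -1` and `σ = 1` are distinct and their union is the
null cone of `II`. -/
def asymptoticLine (i : Fin 2) (q : ℝ × ℝ) : Set (ℝ × ℝ) :=
  {w | forme α q * w.1 + (formf α q + lineSign i * disc α q) * w.2 = 0 ∧
    (formf α q - lineSign i * disc α q) * w.1 + formg α q * w.2 = 0}

/-- A complete asymptotic line of the `i`-th asymptotic foliation parametrized by arc length
(given through a lift `c` to the universal covering). On a compact surface that is hyperbolic
everywhere, the leaves of the foliation are exactly the images `Set.range (cover ∘ c)`
of these curves. -/
structure IsAsymptoticLine (i : Fin 2) (c : ℝ → ℝ × ℝ) : Prop where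
  contDiff : ContDiff ℝ 1 c
  hyperbolic : ∀ t, IsHyperbolic α (c t)
  tangent : ∀ t, deriv c t ∈ asymptoticLine α i (c t)
  arclength : ∀ t, ‖deriv (fun s => coord α (c s).1 (c s).2) t‖ = 1

/-- The limit set of a curve in the torus: the union of its `α`-limit set and its `ω`-limit set,
that is, of the cluster points of `γ t` for `t → -∞` and for `t → +∞`. -/
def limitSet (γ : ℝ → Torus) : Set Torus :=
  {p | MapClusterPt p atBot γ} ∪ {p | MapClusterPt p atTop γ}

end TorusMap

namespace Clifford

/-- The parametrization of the Clifford torus. -/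
def C (u v : ℝ) : E4 :=
  (√2 / 2) • !₂[Real.cos (-u + v), Real.sin (-u + v), Real.cos (u + v), Real.sin (u + v)]

/-- The unit normal of the Clifford torus in `S³`. -/
def N (u v : ℝ) : E4 :=
  (√2 / 2) • !₂[Real.cos (-u + v), Real.sin (-u + v), -Real.cos (u + v), -Real.sin (u + v)]

/-- The profile of the normal deformation. -/
def h (u v : ℝ) : ℝ := Real.sin (2 * v - 2 * u) ^ 2

/-- The normal deformation `α_ε = (C + ε h N) / |C + ε h N|`. -/
def deformation (ε u v : ℝ) : E4 :=
  ‖C u v + (ε * h u v) • N u v‖⁻¹ • (C u v + (ε * h u v) • N u v)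

end Clifford

end

noncomputable section

/-! In the coordinates x = -u + v, y = u + v the deformed torus is (r(x) e^{ix}, q(x) r(x) e^{iy})
with q = (1 - εb)/(1 + εb) and b(x) = sin²(2x): it is invariant under rotation in y. For such a
surface f = 0 and e/g = -(q'' + q)/q, whatever r is. Hence q'' + q > 0 makes every point hyperbolic,
and the asymptotic lines satisfy dy/dx = ± √((q'' + q)/q), a function of x alone. The leaves are
thus translates of one graph, up to reflection, whose rise over a period of x is `height q q2 (2π)`.
If this rise is 2πρ with ρ irrational, the successive crossings of a circle x = const form an orbit
of an irrational rotation, so each leaf accumulates everywhere (`mapClusterPt_graph`,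
`limitSet_eq_univ`).

It remains to find a small ε with ρ irrational. At ε = 0 the slope is 1 and ρ = 1. Expanding √(1 +
q''/q) to second order, the first-order term integrates to zero because (log q)'' is the derivative
of a periodic function; the second-order term has mean -12ε². So ρ < 1 for small ε > 0
(`height_ratio_lt`), and by continuity ρ takes irrational values arbitrarily near ε = 0
(`exists_irrational_rotation`). -/

/-- The derivative of a curve in `ℝ⁴` given by its four components. -/
theorem hasDerivAt_vec4 {a b c d : ℝ → ℝ} {a' b' c' d' t : ℝ} (ha : HasDerivAt a a' t)
    (hb : HasDerivAt b b' t) (hc : HasDerivAt c c' t) (hd : HasDerivAt d d' t) :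
    HasDerivAt (fun s => (!₂[a s, b s, c s, d s] : E4)) !₂[a', b', c', d'] t := by
  have h : HasDerivAt (fun s => ![a s, b s, c s, d s]) ![a', b', c', d'] t := by
    rw [hasDerivAt_pi]
    intro i
    fin_cases i <;> assumption
  exact ((PiLp.continuousLinearEquiv 2 ℝ
    (fun _ : Fin 4 => ℝ)).symm.toContinuousLinearMap.hasFDerivAt.comp_hasDerivAt t h)

theorem inner_vec4 (a b c d a' b' c' d' : ℝ) :
    inner ℝ (!₂[a, b, c, d] : E4) !₂[a', b', c', d'] = a * a' + b * b' + c * c' + d * d' := by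
  simp [PiLp.inner_apply, Fin.sum_univ_four]
  ring

theorem det4_vec4 (a b c d a' b' c' d' a'' b'' c'' d'' a''' b''' c''' d''' : ℝ) :
    TorusMap.det4 !₂[a, b, c, d] !₂[a', b', c', d'] !₂[a'', b'', c'', d'']
      !₂[a''', b''', c''', d'''] =
    Matrix.det !![a, b, c, d; a', b', c', d'; a'', b'', c'', d''; a''', b''', c''', d'''] := by
  unfold TorusMap.det4
  congr 1
  ext i j
  fin_cases i <;> fin_cases j <;> rfl

/-- The map `α` is `(x, y) ↦ (r(x) e^{ix}, q(x) r(x) e^{iy})` in coordinates, with positive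
`2π`-periodic profile functions `r` and `q`, whose first two derivatives are `r1, r2` and `q1, q2`,
and with `q'' + q > 0`. -/
structure IsRotational (α : Torus → S3) (r r1 r2 q q1 q2 : ℝ → ℝ) : Prop where
  coord_eq : ∀ x y, TorusMap.coord α x y = !₂[r x * Real.cos x, r x * Real.sin x,
    q x * r x * Real.cos y, q x * r x * Real.sin y]
  hr : ∀ x, HasDerivAt r (r1 x) x
  hr1 : ∀ x, HasDerivAt r1 (r2 x) x
  hq : ∀ x, HasDerivAt q (q1 x) x
  hq1 : ∀ x, HasDerivAt q1 (q2 x) x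
  r_pos : ∀ x, 0 < r x
  q_pos : ∀ x, 0 < q x
  convex : ∀ x, 0 < q2 x + q x
  continuous_q2 : Continuous q2
  periodic_r : Function.Periodic r (2 * Real.pi)
  periodic_r1 : Function.Periodic r1 (2 * Real.pi)
  periodic_q : Function.Periodic q (2 * Real.pi)
  periodic_q1 : Function.Periodic q1 (2 * Real.pi)
  periodic_q2 : Function.Periodic q2 (2 * Real.pi)

/-! ### Fundamental forms and asymptotic directions of a rotational torus -/

namespace IsRotational

variable {α : Torus → S3} {r r1 r2 q q1 q2 : ℝ → ℝ}

theorem dx_eq (H : IsRotational α r r1 r2 q q1 q2) (x y : ℝ) :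
    TorusMap.dx α x y = !₂[r1 x * Real.cos x - r x * Real.sin x,
      r1 x * Real.sin x + r x * Real.cos x, (q1 x * r x + q x * r1 x) * Real.cos y,
      (q1 x * r x + q x * r1 x) * Real.sin y] := by
  unfold TorusMap.dx
  simp only [H.coord_eq]
  refine (hasDerivAt_vec4 (((H.hr x).mul (Real.hasDerivAt_cos x)).congr_deriv ?_)
    ((H.hr x).mul (Real.hasDerivAt_sin x)) (((H.hq x).mul (H.hr x)).mul_const _)
    (((H.hq x).mul (H.hr x)).mul_const _)).deriv
  ring

theorem dy_eq (H : IsRotational α r r1 r2 q q1 q2) (x y : ℝ) :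
    TorusMap.dy α x y = !₂[0, 0, - (q x * r x * Real.sin y), q x * r x * Real.cos y] := by
  unfold TorusMap.dy
  simp only [H.coord_eq]
  refine (hasDerivAt_vec4 (hasDerivAt_const _ _) (hasDerivAt_const _ _)
    (((Real.hasDerivAt_cos y).const_mul _).congr_deriv ?_)
    ((Real.hasDerivAt_sin y).const_mul _)).deriv
  ring

theorem dxx_eq (H : IsRotational α r r1 r2 q q1 q2) (x y : ℝ) :
    TorusMap.dxx α x y = !₂[(r2 x - r x) * Real.cos x - 2 * r1 x * Real.sin x,
      (r2 x - r x) * Real.sin x + 2 * r1 x * Real.cos x,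
      (q2 x * r x + 2 * q1 x * r1 x + q x * r2 x) * Real.cos y,
      (q2 x * r x + 2 * q1 x * r1 x + q x * r2 x) * Real.sin y] := by
  unfold TorusMap.dxx
  simp only [H.dx_eq]
  have hs := ((H.hq1 x).mul (H.hr x)).add ((H.hq x).mul (H.hr1 x))
  refine (hasDerivAt_vec4 ((((H.hr1 x).mul (Real.hasDerivAt_cos x)).sub
    ((H.hr x).mul (Real.hasDerivAt_sin x))).congr_deriv ?_)
    ((((H.hr1 x).mul (Real.hasDerivAt_sin x)).add
    ((H.hr x).mul (Real.hasDerivAt_cos x))).congr_deriv ?_)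
    ((hs.mul_const _).congr_deriv ?_) ((hs.mul_const _).congr_deriv ?_)).deriv <;> ring

theorem dxy_eq (H : IsRotational α r r1 r2 q q1 q2) (x y : ℝ) :
    TorusMap.dxy α x y = !₂[0, 0, - ((q1 x * r x + q x * r1 x) * Real.sin y),
      (q1 x * r x + q x * r1 x) * Real.cos y] := by
  unfold TorusMap.dxy
  simp only [H.dx_eq]
  refine (hasDerivAt_vec4 (hasDerivAt_const _ _) (hasDerivAt_const _ _)
    (((Real.hasDerivAt_cos y).const_mul _).congr_deriv ?_)
    ((Real.hasDerivAt_sin y).const_mul _)).deriv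
  ring

theorem dyy_eq (H : IsRotational α r r1 r2 q q1 q2) (x y : ℝ) :
    TorusMap.dyy α x y = !₂[0, 0, - (q x * r x * Real.cos y), - (q x * r x * Real.sin y)] := by
  unfold TorusMap.dyy
  simp only [H.dy_eq]
  refine (hasDerivAt_vec4 (hasDerivAt_const _ _) (hasDerivAt_const _ _)
    ((Real.hasDerivAt_sin y).const_mul _).neg
    (((Real.hasDerivAt_cos y).const_mul _).congr_deriv ?_)).deriv
  ring

theorem formE_eq (H : IsRotational α r r1 r2 q q1 q2) (p : ℝ × ℝ) :
    TorusMap.formE α p = r1 p.1 ^ 2 + r p.1 ^ 2 + (q1 p.1 * r p.1 + q p.1 * r1 p.1) ^ 2 := by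
  rw [TorusMap.formE, H.dx_eq, inner_vec4]
  linear_combination (r1 p.1 ^ 2 + r p.1 ^ 2) * Real.sin_sq_add_cos_sq p.1 +
    (q1 p.1 * r p.1 + q p.1 * r1 p.1) ^ 2 * Real.sin_sq_add_cos_sq p.2

theorem formF_eq (H : IsRotational α r r1 r2 q q1 q2) (p : ℝ × ℝ) : TorusMap.formF α p = 0 := by
  rw [TorusMap.formF, H.dx_eq, H.dy_eq, inner_vec4]
  ring

theorem formG_eq (H : IsRotational α r r1 r2 q q1 q2) (p : ℝ × ℝ) :
    TorusMap.formG α p = (q p.1 * r p.1) ^ 2 := by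
  rw [TorusMap.formG, H.dy_eq, inner_vec4]
  linear_combination (q p.1 * r p.1) ^ 2 * Real.sin_sq_add_cos_sq p.2

theorem formE_pos (H : IsRotational α r r1 r2 q q1 q2) (p : ℝ × ℝ) : 0 < TorusMap.formE α p := by
  have := H.r_pos p.1
  rw [H.formE_eq]
  positivity

theorem formG_pos (H : IsRotational α r r1 r2 q q1 q2) (p : ℝ × ℝ) : 0 < TorusMap.formG α p := by
  have := H.r_pos p.1
  have := H.q_pos p.1
  rw [H.formG_eq]
  positivity

theorem area_pos (H : IsRotational α r r1 r2 q q1 q2) (p : ℝ × ℝ) :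
    0 < TorusMap.formE α p * TorusMap.formG α p - TorusMap.formF α p ^ 2 := by
  have := H.formE_pos p
  have := H.formG_pos p
  rw [H.formF_eq]
  nlinarith [mul_pos (H.formE_pos p) (H.formG_pos p)]

/-- Write α = r X with X = (e^{ix}, q e^{iy}). In the determinant the derivatives of r only add
multiples of earlier rows, so r enters through the factor r⁴ and q'' + q comes from X alone. -/
theorem forme_eq (H : IsRotational α r r1 r2 q q1 q2) (p : ℝ × ℝ) :
    TorusMap.forme α p = -(q p.1 * r p.1 ^ 4 * (q2 p.1 + q p.1)) /
      √(TorusMap.formE α p * TorusMap.formG α p - TorusMap.formF α p ^ 2) := by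
  rw [TorusMap.forme, TorusMap.normalPart, H.coord_eq, H.dx_eq, H.dy_eq, H.dxx_eq, det4_vec4]
  congr 1
  simp [Matrix.det_succ_row_zero, Fin.sum_univ_succ, Fin.succAbove]
  linear_combination (-(q p.1 * r p.1 ^ 4 * (q2 p.1 + q p.1))) *
    ((Real.sin p.2 ^ 2 + Real.cos p.2 ^ 2) * Real.sin_sq_add_cos_sq p.1 +
      Real.sin_sq_add_cos_sq p.2)

theorem formf_eq (H : IsRotational α r r1 r2 q q1 q2) (p : ℝ × ℝ) : TorusMap.formf α p = 0 := by
  rw [TorusMap.formf, TorusMap.normalPart, H.coord_eq, H.dx_eq, H.dy_eq, H.dxy_eq, det4_vec4]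
  simp [Matrix.det_succ_row_zero, Fin.sum_univ_succ, Fin.succAbove]
  left
  ring

theorem formg_eq (H : IsRotational α r r1 r2 q q1 q2) (p : ℝ × ℝ) :
    TorusMap.formg α p = q p.1 ^ 2 * r p.1 ^ 4 /
      √(TorusMap.formE α p * TorusMap.formG α p - TorusMap.formF α p ^ 2) := by
  rw [TorusMap.formg, TorusMap.normalPart, H.coord_eq, H.dx_eq, H.dy_eq, H.dyy_eq, det4_vec4]
  congr 1
  simp [Matrix.det_succ_row_zero, Fin.sum_univ_succ, Fin.succAbove]
  linear_combination (q p.1 ^ 2 * r p.1 ^ 4) *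
    ((Real.sin p.2 ^ 2 + Real.cos p.2 ^ 2) * Real.sin_sq_add_cos_sq p.1 +
      Real.sin_sq_add_cos_sq p.2)

/-- The absolute value of the slope of the asymptotic lines. -/
def slope (q q2 : ℝ → ℝ) (x : ℝ) : ℝ := √((q2 x + q x) / q x)

theorem slope_pos (H : IsRotational α r r1 r2 q q1 q2) (x : ℝ) : 0 < slope q q2 x :=
  Real.sqrt_pos.2 (div_pos (H.convex x) (H.q_pos x))

theorem formg_pos (H : IsRotational α r r1 r2 q q1 q2) (p : ℝ × ℝ) : 0 < TorusMap.formg α p := by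
  have := H.r_pos p.1
  have := H.q_pos p.1
  rw [H.formg_eq]
  exact div_pos (by positivity) (Real.sqrt_pos.2 (H.area_pos p))

theorem forme_eq_slope (H : IsRotational α r r1 r2 q q1 q2) (p : ℝ × ℝ) :
    TorusMap.forme α p = - (slope q q2 p.1 ^ 2 * TorusMap.formg α p) := by
  rw [slope, Real.sq_sqrt (div_pos (H.convex _) (H.q_pos _)).le, H.forme_eq, H.formg_eq]
  have := (H.q_pos p.1).ne'
  field_simp

theorem disc_eq (H : IsRotational α r r1 r2 q q1 q2) (p : ℝ × ℝ) :
    TorusMap.disc α p = slope q q2 p.1 * TorusMap.formg α p := by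
  have := H.slope_pos p.1
  have := H.formg_pos p
  rw [TorusMap.disc, H.formf_eq, H.forme_eq_slope]
  rw [show (0:ℝ) ^ 2 - -(slope q q2 p.1 ^ 2 * TorusMap.formg α p) * TorusMap.formg α p =
    (slope q q2 p.1 * TorusMap.formg α p) ^ 2 by ring]
  exact Real.sqrt_sq (by positivity)

theorem isHyperbolic (H : IsRotational α r r1 r2 q q1 q2) (p : ℝ × ℝ) :
    TorusMap.IsHyperbolic α p := by
  have h1 := H.slope_pos p.1
  have h2 := H.formg_pos p
  have h3 : 0 < slope q q2 p.1 ^ 2 * TorusMap.formg α p * TorusMap.formg α p := by positivity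
  refine div_neg_of_neg_of_pos ?_ (H.area_pos p)
  rw [H.formf_eq, H.forme_eq_slope]
  linarith

theorem lineSign_sq (i : Fin 2) : TorusMap.lineSign i ^ 2 = 1 := by
  fin_cases i <;> simp [TorusMap.lineSign]

/-- With f = 0, e = -s²g and D = sg, where s is `slope`, the second equation divided by g > 0 is the
slope equation. The first is then redundant because σ² = 1. -/
theorem mem_asymptoticLine_iff (H : IsRotational α r r1 r2 q q1 q2) (i : Fin 2) (p w : ℝ × ℝ) :
    w ∈ TorusMap.asymptoticLine α i p ↔ w.2 = TorusMap.lineSign i * slope q q2 p.1 * w.1 := by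
  have h2 := H.formg_pos p
  have hs := lineSign_sq i
  simp only [TorusMap.asymptoticLine, Set.mem_ofPred_eq, H.formf_eq, H.disc_eq, H.forme_eq_slope]
  constructor
  · rintro ⟨-, h⟩
    apply mul_left_cancel₀ h2.ne'
    linear_combination h
  · intro h
    rw [h]
    constructor
    · linear_combination (slope q q2 p.1 ^ 2 * TorusMap.formg α p * w.1) * hs
    · ring

/-- The speed of an asymptotic line parametrized by `x`. -/
def speed (r r1 q q1 q2 : ℝ → ℝ) (x : ℝ) : ℝ :=
  √(r1 x ^ 2 + r x ^ 2 + (q1 x * r x + q x * r1 x) ^ 2 + (q x * r x * slope q q2 x) ^ 2)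

theorem norm_deriv_coord (H : IsRotational α r r1 r2 q q1 q2) (i : Fin 2) {c : ℝ → ℝ × ℝ} {t : ℝ}
    (hc : DifferentiableAt ℝ c t) (hl : deriv c t ∈ TorusMap.asymptoticLine α i (c t)) :
    ‖deriv (fun s => TorusMap.coord α (c s).1 (c s).2) t‖ =
      speed r r1 q q1 q2 (c t).1 * |(deriv c t).1| := by
  rw [H.mem_asymptoticLine_iff] at hl
  have h1 : HasDerivAt (fun s => (c s).1) (deriv c t).1 t := by
    simpa using hc.hasDerivAt.hasFDerivAt.fst.hasDerivAt
  have h2 : HasDerivAt (fun s => (c s).2) (deriv c t).2 t := by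
    simpa using hc.hasDerivAt.hasFDerivAt.snd.hasDerivAt
  have hy : (deriv c t).2 ^ 2 = slope q q2 (c t).1 ^ 2 * (deriv c t).1 ^ 2 := by
    rw [hl]
    linear_combination (slope q q2 (c t).1 ^ 2 * (deriv c t).1 ^ 2) * lineSign_sq i
  have hr : HasDerivAt (fun s => r (c s).1) _ t := (H.hr (c t).1).comp t h1
  have hq : HasDerivAt (fun s => q (c s).1) _ t := (H.hq (c t).1).comp t h1
  have hd := (hasDerivAt_vec4 (hr.mul h1.cos) (hr.mul h1.sin) ((hq.mul hr).mul h2.cos)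
    ((hq.mul hr).mul h2.sin)).deriv
  simp only [Pi.mul_apply] at hd
  simp only [H.coord_eq]
  rw [hd, speed, ← Real.sqrt_sq_eq_abs, ← Real.sqrt_mul (by positivity),
    EuclideanSpace.norm_eq]
  congr 1
  simp [Fin.sum_univ_four]
  generalize (deriv c t).1 = x' at *
  generalize (deriv c t).2 = y' at *
  generalize (c t).1 = x at *
  generalize (c t).2 = y at *
  linear_combination (q x * r x) ^ 2 * hy + (r1 x ^ 2 + r x ^ 2) * x' ^ 2 *
    Real.sin_sq_add_cos_sq x + ((q1 x * r x + q x * r1 x) ^ 2 * x' ^ 2 + (q x * r x) ^ 2 * y' ^ 2) *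
    Real.sin_sq_add_cos_sq y

end IsRotational

/-! ### Irrational rotations, graphs over the line and reparametrization -/

/-- The powers of `e^{2πiρ}`, `ρ` irrational, are dense in the circle. -/
theorem denseRange_exp_zpow {ρ : ℝ} (hρ : Irrational ρ) :
    DenseRange (fun n : ℤ => Circle.exp (2 * Real.pi * ρ) ^ n) := by
  have h : Irrational (2 * Real.pi * ρ / (2 * Real.pi)) := by
    rwa [mul_div_cancel_left₀ _ Real.two_pi_pos.ne']
  have := (AddCircle.homeomorphCircle'.surjective.denseRange).comp
    (AddCircle.denseRange_zsmul_coe_iff.2 h) AddCircle.homeomorphCircle'.continuous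
  refine this.mono ?_
  rintro _ ⟨n, rfl⟩
  refine ⟨n, ?_⟩
  simp only [Function.comp]
  rw [← AddCircle.coe_zsmul, AddCircle.homeomorphCircle'_apply_mk, zsmul_eq_mul,
    Circle.exp_intCast_mul]

/-- In a compact group the cluster points of the positive powers of an element fill the closure of
the subgroup it generates, so density of the integer powers suffices. -/
theorem mapClusterPt_exp_pow {ρ : ℝ} (hρ : Irrational ρ) (z : Circle) :
    MapClusterPt z atTop (fun n : ℕ => Circle.exp (2 * Real.pi * ρ) ^ n) := by
  rw [mapClusterPt_atTop_pow_iff_mem_topologicalClosure_zpowers]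
  exact denseRange_exp_zpow hρ z

theorem add_two_pi_mul_nat {F : ℝ → ℝ} {κ : ℝ} (hF : ∀ s, F (s + 2 * Real.pi) = F s + κ) (s : ℝ)
    (n : ℕ) : F (s + n * (2 * Real.pi)) = F s + n * κ := by
  induction n with
  | zero => simp
  | succ n ih =>
    rw [Nat.cast_succ, add_one_mul, ← add_assoc, hF, ih]
    ring

/-- A curve in the torus that runs to the right along a graph `y = F(x)` whose rotation number is
irrational accumulates everywhere. -/
theorem mapClusterPt_graph {F x : ℝ → ℝ} {ρ : ℝ} (hρ : Irrational ρ)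
    (hF : ∀ s, F (s + 2 * Real.pi) = F s + 2 * Real.pi * ρ) (hx : Continuous x)
    (hlim : Tendsto x atTop atTop) (p : Torus) :
    MapClusterPt p atTop (fun t => cover (x t, F (x t))) := by
  set s := Complex.arg p.1
  have hs : Circle.exp s = p.1 := Circle.exp_arg p.1
  rw [mapClusterPt_iff_frequently]
  intro U hU
  have hc : ContinuousAt (fun b : Circle => ((p.1, Circle.exp (F s) * b) : Torus))
      ((Circle.exp (F s))⁻¹ * p.2) := by fun_prop
  -- The graph meets the circle x = s + 2πn at the angle F(s) + 2πρn; infinitely many n bring this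
  -- point into U.
  have hV := (mapClusterPt_exp_pow hρ ((Circle.exp (F s))⁻¹ * p.2)).frequently
    (hc.eventually (p := fun b => b ∈ U) (by simpa using hU))
  rw [frequently_atTop]
  intro T
  have hlarge : ∀ᶠ n : ℕ in atTop, x T ≤ s + n * (2 * Real.pi) :=
    (tendsto_atTop_add_const_left _ s
      (tendsto_natCast_atTop_atTop.atTop_mul_const Real.two_pi_pos)).eventually_ge_atTop _
  obtain ⟨n, hnU, hn⟩ := (hV.and_eventually hlarge).exists
  -- At time T the curve is still to the left of s + 2πn and at time S it has passed it, so it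
  -- crosses at some time t ≥ T.
  obtain ⟨S, hS, hST⟩ := ((hlim.eventually_ge_atTop (s + n * (2 * Real.pi))).and
    (eventually_ge_atTop T)).exists
  obtain ⟨t, ht, hxt⟩ := intermediate_value_Icc hST hx.continuousOn ⟨hn, hS⟩
  refine ⟨t, ht.1, ?_⟩
  have hF' := add_two_pi_mul_nat hF s n
  have h1 : Circle.exp (s + n * (2 * Real.pi)) = p.1 := by
    rw [← hs, Circle.exp_add, Circle.exp_natCast_mul, Circle.exp_two_pi, one_pow, mul_one]
  simp only [cover]
  rw [hxt, hF', h1, Circle.exp_add, Circle.exp_natCast_mul]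
  exact hnU

theorem tendsto_of_le_deriv {x x' : ℝ → ℝ} {κ : ℝ} (hκ : 0 < κ) (hx : ∀ t, HasDerivAt x (x' t) t)
    (h : ∀ t, κ ≤ x' t) : Tendsto x atTop atTop ∧ Tendsto x atBot atBot := by
  have hm : Monotone (fun t => x t - κ * t) := by
    refine monotone_of_hasDerivAt_nonneg (f' := fun t => x' t - κ) (fun t => ?_)
      (fun t => sub_nonneg.2 (h t))
    exact (hx t).fun_sub (((hasDerivAt_id t).const_mul κ).congr_deriv (mul_one κ))
  constructor
  · have h1 : Tendsto (fun t => κ * t + x 0) atTop atTop :=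
      tendsto_atTop_add_const_right _ _ (tendsto_id.const_mul_atTop hκ)
    refine tendsto_atTop_mono' _ ?_ h1
    filter_upwards [eventually_ge_atTop 0] with t ht
    have := hm ht
    simp only [mul_zero, sub_zero] at this
    linarith
  · have h1 : Tendsto (fun t => κ * t + x 0) atBot atBot :=
      tendsto_atBot_add_const_right _ _ (tendsto_id.const_mul_atBot hκ)
    refine tendsto_atBot_mono' _ ?_ h1
    filter_upwards [eventually_le_atBot 0] with t ht
    have := hm ht
    simp only [mul_zero, sub_zero] at this
    linarith

/-- Parametrization of the line with a prescribed positive speed density. -/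
theorem exists_unit_speed {l : ℝ → ℝ} {κ : ℝ} (hl : Continuous l) (hκ : 0 < κ) (h : ∀ s, κ ≤ l s)
    (x₀ : ℝ) : ∃ x : ℝ → ℝ, x 0 = x₀ ∧ ∀ t, HasDerivAt x (l (x t))⁻¹ t := by
  have hd : ∀ s, HasDerivAt (fun s => ∫ z in x₀..s, l z) (l s) s := fun s =>
    intervalIntegral.integral_hasDerivAt_right (hl.intervalIntegrable _ _)
      (hl.stronglyMeasurableAtFilter _ _) hl.continuousAt
  set L : ℝ → ℝ := fun s => ∫ z in x₀..s, l z
  have hpos : ∀ s, 0 < l s := fun s => hκ.trans_le (h s)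
  have hmono : StrictMono L := strictMono_of_hasDerivAt_pos hd hpos
  have hcont : Continuous L := continuous_iff_continuousAt.2 fun s => (hd s).continuousAt
  -- The lower bound κ makes the arc length function L onto ℝ, so that its inverse, the desired x,
  -- is defined for all times.
  obtain ⟨h1, h2⟩ := tendsto_of_le_deriv hκ hd h
  have hsurj : Function.Surjective L := hcont.surjective h1 h2
  let e := (hmono.orderIsoOfSurjective L hsurj).toHomeomorph
  have he : ∀ s, e s = L s := fun s => rfl
  refine ⟨e.symm, ?_, fun t => ?_⟩
  · rw [Homeomorph.symm_apply_eq, he]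
    simp [L]
  · refine HasDerivAt.of_local_left_inverse e.symm.continuous.continuousAt (hd _) (hpos _).ne' ?_
    exact Eventually.of_forall fun y => e.apply_symm_apply y

theorem exists_bounds_of_periodic {l : ℝ → ℝ} {T : ℝ} (hT : 0 < T) (hl : Continuous l)
    (hp : Function.Periodic l T) (hpos : ∀ s, 0 < l s) :
    ∃ κ K : ℝ, 0 < κ ∧ 0 < K ∧ ∀ s, κ ≤ l s ∧ l s ≤ K := by
  have hne : (Set.Icc 0 T).Nonempty := ⟨0, Set.left_mem_Icc.2 hT.le⟩
  obtain ⟨a, -, ha⟩ := isCompact_Icc.exists_isMinOn hne hl.continuousOn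
  obtain ⟨b, -, hb⟩ := isCompact_Icc.exists_isMaxOn hne hl.continuousOn
  refine ⟨l a, l b, hpos a, hpos b, fun s => ?_⟩
  obtain ⟨y, hy, hys⟩ := hp.exists_mem_Ico₀ hT s
  rw [hys]
  exact ⟨ha ⟨hy.1, hy.2.le⟩, hb ⟨hy.1, hy.2.le⟩⟩

theorem pos_or_neg_of_continuous {f : ℝ → ℝ} (hf : Continuous f) (h : ∀ t, f t ≠ 0) :
    (∀ t, 0 < f t) ∨ ∀ t, f t < 0 := by
  by_contra! hcon
  obtain ⟨⟨a, ha⟩, b, hb⟩ := hcon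
  obtain ⟨c, hc⟩ := mem_range_of_exists_le_of_exists_ge hf ⟨a, ha⟩ ⟨b, hb⟩
  exact h c hc

/-! ### Completeness and limit sets of the asymptotic lines -/

namespace IsRotational

variable {α : Torus → S3} {r r1 r2 q q1 q2 : ℝ → ℝ}

theorem continuous_q (H : IsRotational α r r1 r2 q q1 q2) : Continuous q :=
  continuous_iff_continuousAt.2 fun x => (H.hq x).continuousAt

theorem continuous_slope (H : IsRotational α r r1 r2 q q1 q2) : Continuous (slope q q2) :=
  ((H.continuous_q2.add H.continuous_q).div H.continuous_q fun x => (H.q_pos x).ne').sqrt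

theorem continuous_speed (H : IsRotational α r r1 r2 q q1 q2) :
    Continuous (speed r r1 q q1 q2) := by
  have h1 := H.continuous_q
  have h2 := H.continuous_slope
  have h3 : Continuous r := continuous_iff_continuousAt.2 fun x => (H.hr x).continuousAt
  have h4 : Continuous r1 := continuous_iff_continuousAt.2 fun x => (H.hr1 x).continuousAt
  have h5 : Continuous q1 := continuous_iff_continuousAt.2 fun x => (H.hq1 x).continuousAt
  unfold speed
  fun_prop

theorem speed_pos (H : IsRotational α r r1 r2 q q1 q2) (x : ℝ) : 0 < speed r r1 q q1 q2 x := by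
  have := H.r_pos x
  exact Real.sqrt_pos.2 (by positivity)

theorem periodic_slope (H : IsRotational α r r1 r2 q q1 q2) :
    Function.Periodic (slope q q2) (2 * Real.pi) := fun x => by
  simp only [slope, H.periodic_q x, H.periodic_q2 x]

theorem periodic_speed (H : IsRotational α r r1 r2 q q1 q2) :
    Function.Periodic (speed r r1 q q1 q2) (2 * Real.pi) := fun x => by
  simp only [speed, H.periodic_q x, H.periodic_q1 x, H.periodic_r x, H.periodic_r1 x,
    H.periodic_slope x]

/-- The height of the asymptotic lines over the `x`-axis. -/
def height (q q2 : ℝ → ℝ) (x : ℝ) : ℝ := ∫ z in (0 : ℝ)..x, slope q q2 z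

theorem hasDerivAt_height (H : IsRotational α r r1 r2 q q1 q2) (x : ℝ) :
    HasDerivAt (height q q2) (slope q q2 x) x :=
  intervalIntegral.integral_hasDerivAt_right (H.continuous_slope.intervalIntegrable _ _)
    (H.continuous_slope.stronglyMeasurableAtFilter _ _) H.continuous_slope.continuousAt

theorem height_add_two_pi (H : IsRotational α r r1 r2 q q1 q2) (x : ℝ) :
    height q q2 (x + 2 * Real.pi) = height q q2 x + height q q2 (2 * Real.pi) := by
  have := H.periodic_slope.intervalIntegral_add_eq_add 0 x
    fun a b => H.continuous_slope.intervalIntegrable a b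
  simpa [height] using this

/-- Through every point of the torus passes a complete asymptotic line. -/
theorem exists_isAsymptoticLine (H : IsRotational α r r1 r2 q q1 q2) (i : Fin 2) (p : Torus) :
    ∃ c : ℝ → ℝ × ℝ, TorusMap.IsAsymptoticLine α i c ∧ cover (c 0) = p := by
  obtain ⟨κ, K, hκ, -, hb⟩ := exists_bounds_of_periodic Real.two_pi_pos H.continuous_speed
    H.periodic_speed H.speed_pos
  obtain ⟨x, hx0, hx⟩ := exists_unit_speed H.continuous_speed hκ (fun s => (hb s).1)
    (Complex.arg p.1)
  set σ := TorusMap.lineSign i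
  -- A leaf keeps y - σ `height`(x) constant, which forces y once x has been chosen with unit speed.
  set y : ℝ → ℝ := fun t => Complex.arg p.2 +
    σ * (height q q2 (x t) - height q q2 (Complex.arg p.1))
  have hxc : Continuous x := continuous_iff_continuousAt.2 fun t => (hx t).continuousAt
  have hy : ∀ t, HasDerivAt y (σ * (slope q q2 (x t) * (speed r r1 q q1 q2 (x t))⁻¹)) t := fun t =>
    ((((H.hasDerivAt_height (x t)).comp t (hx t)).sub_const _).const_mul σ).const_add _
  have hc : ∀ t, HasDerivAt (fun t => (x t, y t)) ((speed r r1 q q1 q2 (x t))⁻¹,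
      σ * (slope q q2 (x t) * (speed r r1 q q1 q2 (x t))⁻¹)) t := fun t => (hx t).prodMk (hy t)
  have hline : ∀ t, deriv (fun t => (x t, y t)) t ∈ TorusMap.asymptoticLine α i (x t, y t) := by
    intro t
    rw [H.mem_asymptoticLine_iff, (hc t).deriv, mul_assoc]
  refine ⟨fun t => (x t, y t), ⟨?_, fun t => H.isHyperbolic _, hline, fun t => ?_⟩, ?_⟩
  · rw [contDiff_one_iff_deriv]
    refine ⟨fun t => (hc t).differentiableAt, ?_⟩
    rw [show deriv (fun t => (x t, y t)) = _ from funext fun t => (hc t).deriv]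
    have h1 : Continuous fun t => speed r r1 q q1 q2 (x t) := H.continuous_speed.comp hxc
    have h2 : Continuous fun t => slope q q2 (x t) := H.continuous_slope.comp hxc
    have h3 : Continuous fun t => (speed r r1 q q1 q2 (x t))⁻¹ :=
      h1.inv₀ fun t => (H.speed_pos _).ne'
    fun_prop
  · rw [H.norm_deriv_coord i (hc t).differentiableAt (hline t), (hc t).deriv]
    have := H.speed_pos (x t)
    rw [abs_of_pos (inv_pos.2 this), mul_inv_cancel₀ this.ne']
  · simp [cover, hx0, y]

/-- If the rotation number is irrational, the limit set of every asymptotic line is the torus. -/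
theorem limitSet_eq_univ (H : IsRotational α r r1 r2 q q1 q2) {ρ : ℝ} (hρ : Irrational ρ)
    (hht : height q q2 (2 * Real.pi) = 2 * Real.pi * ρ) {i : Fin 2} {c : ℝ → ℝ × ℝ}
    (hc : TorusMap.IsAsymptoticLine α i c) : TorusMap.limitSet (cover ∘ c) = Set.univ := by
  obtain ⟨κ, K, -, hK, hb⟩ := exists_bounds_of_periodic Real.two_pi_pos H.continuous_speed
    H.periodic_speed H.speed_pos
  set σ := TorusMap.lineSign i with hσ
  have hdiff : ∀ t, HasDerivAt c (deriv c t) t := fun t =>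
    (hc.contDiff.differentiable one_ne_zero t).hasDerivAt
  have hx : ∀ t, HasDerivAt (fun s => (c s).1) (deriv c t).1 t := fun t => by
    simpa using (hdiff t).hasFDerivAt.fst.hasDerivAt
  have hy : ∀ t, HasDerivAt (fun s => (c s).2) (deriv c t).2 t := fun t => by
    simpa using (hdiff t).hasFDerivAt.snd.hasDerivAt
  have hspeed : ∀ t, speed r r1 q q1 q2 (c t).1 * |(deriv c t).1| = 1 := fun t => by
    rw [← H.norm_deriv_coord i (hdiff t).differentiableAt (hc.tangent t), hc.arclength]
  -- Unit length and speed density at most K keep |x'| away from zero, so the line runs over the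
  -- whole x-axis.
  have hlow : ∀ t, K⁻¹ ≤ |(deriv c t).1| := fun t => by
    rw [inv_le_iff_one_le_mul₀ hK, ← hspeed t]
    nlinarith [mul_le_mul_of_nonneg_left (hb (c t).1).2 (abs_nonneg (deriv c t).1)]
  have hgraph : ∀ t, (c t).2 = (c 0).2 - σ * height q q2 (c 0).1 + σ * height q q2 (c t).1 := by
    have hd : ∀ t, HasDerivAt (fun s => (c s).2 - σ * height q q2 (c s).1) 0 t := fun t => by
      refine ((hy t).sub (((H.hasDerivAt_height (c t).1).comp t (hx t)).const_mul σ)).congr_deriv ?_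
      rw [(H.mem_asymptoticLine_iff i _ _).1 (hc.tangent t)]
      ring
    intro t
    have := is_const_of_deriv_eq_zero (fun t => (hd t).differentiableAt) (fun t => (hd t).deriv) t 0
    linarith
  set F : ℝ → ℝ := fun s => (c 0).2 - σ * height q q2 (c 0).1 + σ * height q q2 s with hFdef
  have hρ' : Irrational (σ * ρ) := by
    rw [hσ]
    fin_cases i <;> simpa [TorusMap.lineSign] using hρ
  have hF : ∀ s, F (s + 2 * Real.pi) = F s + 2 * Real.pi * (σ * ρ) := fun s => by
    simp only [hFdef, H.height_add_two_pi, hht]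
    ring
  have hcov : cover ∘ c = fun t => cover ((c t).1, F (c t).1) := by
    funext t
    simp only [Function.comp, hFdef]
    rw [← hgraph t]
  have hxc : Continuous fun t => (c t).1 := continuous_fst.comp hc.contDiff.continuous
  have hx'c : Continuous fun t => (deriv c t).1 :=
    continuous_fst.comp (hc.contDiff.continuous_deriv le_rfl)
  rw [Set.eq_univ_iff_forall]
  intro p
  have hne : ∀ t, (deriv c t).1 ≠ 0 := fun t h0 => by
    have := hspeed t
    simp [h0] at this
  rw [hcov]
  -- One end of the leaf suffices: where x increases the ω-limit set is already everything; where x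
  -- decreases, reversing time gives the same for the α-limit set.
  rcases pos_or_neg_of_continuous hx'c hne with hs | hs
  · right
    refine mapClusterPt_graph hρ' hF hxc (tendsto_of_le_deriv (inv_pos.2 hK) hx fun t => ?_).1 p
    rw [← abs_of_pos (hs t)]
    exact hlow t
  · left
    have hx2 : ∀ t, HasDerivAt (fun s => (c (-s)).1) (-(deriv c (-t)).1) t := fun t => by
      exact ((hx (-t)).comp t (hasDerivAt_neg t)).congr_deriv (by ring)
    have := mapClusterPt_graph (x := fun t => (c (-t)).1) hρ' hF (hxc.comp continuous_neg)
      (tendsto_of_le_deriv (inv_pos.2 hK) hx2 fun t => by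
        rw [← abs_of_neg (hs (-t))]
        exact hlow (-t)).1 p
    exact MapClusterPt.of_comp (φ := Neg.neg) tendsto_neg_atTop_atBot this

theorem dense_of_limitSet_eq_univ {γ : ℝ → Torus} (h : TorusMap.limitSet γ = Set.univ) :
    Dense (Set.range γ) := by
  intro p
  rw [mem_closure_iff_nhds]
  intro U hU
  have hp : p ∈ TorusMap.limitSet γ := h ▸ Set.mem_univ p
  rcases hp with hp | hp <;>
  · obtain ⟨t, ht⟩ := (hp.frequently hU).exists
    exact ⟨γ t, ht, t, rfl⟩

end IsRotational

/-! ### The profile ratio and second-order estimates of the slope -/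

namespace Clifford

/-- The profile `sin²(2x)` of the deformation in the coordinate `x = -u + v`. -/
def bump (x : ℝ) : ℝ := Real.sin (2 * x) ^ 2

theorem bump_nonneg (x : ℝ) : 0 ≤ bump x := sq_nonneg _

theorem bump_le_one (x : ℝ) : bump x ≤ 1 := Real.sin_sq_le_one _

theorem hasDerivAt_bump (x : ℝ) : HasDerivAt bump (2 * Real.sin (4 * x)) x := by
  have h := (((hasDerivAt_id x).const_mul 2).sin).pow 2
  refine h.congr_deriv ?_
  rw [show 4 * x = 2 * (2 * x) by ring, Real.sin_two_mul (2 * x)]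
  simp
  ring

theorem hasDerivAt_bump' (x : ℝ) :
    HasDerivAt (fun x => 2 * Real.sin (4 * x)) (8 * Real.cos (4 * x)) x := by
  refine ((((hasDerivAt_id x).const_mul 4).sin).const_mul 2).congr_deriv ?_
  simp
  ring

/-- The ratio `(1 - εh) / (1 + εh)` of the radii of the two circles. -/
def ratio (ε x : ℝ) : ℝ := (1 - ε * bump x) / (1 + ε * bump x)

/-- The first derivative of `ratio ε`. -/
def ratio' (ε x : ℝ) : ℝ := -2 * (ε * (2 * Real.sin (4 * x))) / (1 + ε * bump x) ^ 2

/-- The second derivative of `ratio ε`. -/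
def ratio'' (ε x : ℝ) : ℝ :=
  (-2 * (ε * (8 * Real.cos (4 * x))) * (1 + ε * bump x) + 4 * (ε * (2 * Real.sin (4 * x))) ^ 2) /
    (1 + ε * bump x) ^ 3

variable {ε : ℝ}

theorem one_add_pos (h0 : 0 ≤ ε) (x : ℝ) : 0 < 1 + ε * bump x := by
  have := mul_nonneg h0 (bump_nonneg x)
  linarith

theorem one_sub_pos (h0 : 0 ≤ ε) (h1 : ε ≤ 1 / 100) (x : ℝ) : 0 < 1 - ε * bump x := by
  nlinarith [bump_nonneg x, bump_le_one x]

theorem ratio_pos (h0 : 0 ≤ ε) (h1 : ε ≤ 1 / 100) (x : ℝ) : 0 < ratio ε x :=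
  div_pos (one_sub_pos h0 h1 x) (one_add_pos h0 x)

theorem hasDerivAt_ratio (h0 : 0 ≤ ε) (x : ℝ) : HasDerivAt (ratio ε) (ratio' ε x) x := by
  have h := one_add_pos h0 x
  refine ((((hasDerivAt_bump x).const_mul ε).const_sub 1).div
    (((hasDerivAt_bump x).const_mul ε).const_add 1) h.ne').congr_deriv ?_
  rw [ratio']
  congr 1
  ring

theorem hasDerivAt_ratio' (h0 : 0 ≤ ε) (x : ℝ) : HasDerivAt (ratio' ε) (ratio'' ε x) x := by
  have h := one_add_pos h0 x
  refine ((((hasDerivAt_bump' x).const_mul ε).const_mul (-2)).div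
    ((((hasDerivAt_bump x).const_mul ε).const_add 1).pow 2) (pow_ne_zero 2 h.ne')).congr_deriv ?_
  rw [ratio'']
  simp only [Pi.pow_apply]
  field_simp
  ring

/-- A third order upper bound for the square root. -/
theorem sqrt_one_add_le {z : ℝ} (hz : |z| ≤ 1) : √(1 + z) ≤ 1 + z / 2 - z ^ 2 / 8 + z ^ 3 / 16 := by
  obtain ⟨hz1, hz2⟩ := abs_le.1 hz
  apply Real.sqrt_le_iff.2 ⟨?_, ?_⟩
  · nlinarith [mul_nonneg (sq_nonneg z) (by linarith : 0 ≤ z + 1)]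
  · have h4 : 0 ≤ z ^ 4 := by positivity
    -- The square of the right side exceeds 1 + z by exactly z⁴(5/64 - z/64 + z²/256).
    nlinarith [mul_nonneg h4 (by nlinarith : 0 ≤ 5 / 64 - z / 64 + z ^ 2 / 256)]

/-- The quotient `q''/q` is `-2εh''` up to second order. -/
theorem quotient_bound {ε k a b ζ : ℝ} (h0 : 0 ≤ ε) (h1 : ε ≤ 1 / 100) (hk : 0 ≤ k) (hkε : k ≤ ε)
    (ha : |a| ≤ 2) (hb : |b| ≤ 8)
    (hζ : ζ * ((1 + k) ^ 2 * (1 - k)) = -2 * b * (1 + k) + 4 * ε * a ^ 2) :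
    |ζ + 2 * b| ≤ 17 * ε := by
  have hD : 99 / 100 ≤ (1 + k) ^ 2 * (1 - k) := by nlinarith [mul_nonneg hk hk]
  have ha2 : a ^ 2 ≤ 4 := by
    rw [← sq_abs]
    nlinarith [abs_nonneg a]
  have hη : (ζ + 2 * b) * ((1 + k) ^ 2 * (1 - k)) = 4 * ε * a ^ 2 - 2 * b * ((1 + k) * k ^ 2) := by
    linear_combination hζ
  have hk2 : (1 + k) * k ^ 2 ≤ 102 / 10000 * ε := by
    have : k ^ 2 ≤ 1 / 100 * ε := by nlinarith
    nlinarith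
  have hk2' : 0 ≤ (1 + k) * k ^ 2 := by positivity
  obtain ⟨hb1, hb2⟩ := abs_le.1 hb
  have h3 : |(ζ + 2 * b) * ((1 + k) ^ 2 * (1 - k))| ≤ 165 / 10 * ε := by
    rw [hη, abs_le]
    constructor <;> nlinarith [mul_nonneg h0 (sq_nonneg a), mul_le_mul_of_nonneg_left ha2 h0,
      mul_nonneg hk2' (by linarith : 0 ≤ 8 - b), mul_nonneg hk2' (by linarith : 0 ≤ 8 + b)]
  rw [abs_mul, abs_of_pos (by linarith : 0 < (1 + k) ^ 2 * (1 - k))] at h3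
  nlinarith [abs_nonneg (ζ + 2 * b)]

/-- Second order expansion of the slope of the asymptotic lines; the first order term is a
derivative. -/
theorem slope_bound {ε k a b ζ p : ℝ} (h0 : 0 ≤ ε) (h1 : ε ≤ 1 / 100) (hk : 0 ≤ k) (hkε : k ≤ ε)
    (ha : |a| ≤ 2) (hb : |b| ≤ 8)
    (hζ : ζ * ((1 + k) ^ 2 * (1 - k)) = -2 * b * (1 + k) + 4 * ε * a ^ 2)
    (hp : p * ((1 + k) * (1 - k)) = -2 * (ε * a)) :
    √(1 + ε * ζ) ≤
      1 + (ε * ζ - p ^ 2) / 2 + ε ^ 2 * (2 * a ^ 2 - b ^ 2 / 2) + 400 * ε ^ 3 := by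
  have hη := abs_le.1 (quotient_bound h0 h1 hk hkε ha hb hζ)
  obtain ⟨hη1, hη2⟩ := hη
  obtain ⟨hb1, hb2⟩ := abs_le.1 hb
  have ha2 : a ^ 2 ≤ 4 := by
    rw [← sq_abs]
    nlinarith [abs_nonneg a]
  have hζ17 : |ζ| ≤ 17 := abs_le.2 ⟨by linarith, by linarith⟩
  -- With ζ = -2b + η and |η| ≤ 17ε, the cross term 4bη is at most 4 · 8 · 17ε = 544ε in absolute
  -- value.
  have hsq : 4 * b ^ 2 - 560 * ε ≤ ζ ^ 2 := by
    nlinarith [mul_nonneg (by linarith : 0 ≤ 17 * ε - (ζ + 2 * b)) (by linarith : 0 ≤ 8 + b),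
      mul_nonneg (by linarith : 0 ≤ 17 * ε + (ζ + 2 * b)) (by linarith : 0 ≤ 8 + b),
      mul_nonneg (by linarith : 0 ≤ 17 * ε - (ζ + 2 * b)) (by linarith : 0 ≤ 8 - b),
      mul_nonneg (by linarith : 0 ≤ 17 * ε + (ζ + 2 * b)) (by linarith : 0 ≤ 8 - b),
      sq_nonneg (ζ + 2 * b)]
  have hcube : ζ ^ 3 ≤ 4913 := by
    have := pow_le_pow_left₀ (abs_nonneg ζ) hζ17 3
    have h2 := le_abs_self (ζ ^ 3)
    rw [abs_pow] at h2
    linarith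
  have hk2 : k ^ 2 ≤ 1 / 100 * ε := by nlinarith
  have hp2 : p ^ 2 ≤ 4 * ε ^ 2 * a ^ 2 + 2 * ε ^ 3 := by
    have hE : p ^ 2 * (1 - k ^ 2) ^ 2 = 4 * ε ^ 2 * a ^ 2 := by
      linear_combination (p * ((1 + k) * (1 - k)) - 2 * (ε * a)) * hp
    -- Since k² ≤ ε/100, the factor 1 + ε/8 outweighs the loss in (1 - k²)²; as a² ≤ 4 it costs at
    -- most 2ε³ in `hp2`.
    have hD : 1 ≤ (1 - k ^ 2) ^ 2 * (1 + ε / 8) := by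
      have : 1 - 2 * k ^ 2 ≤ (1 - k ^ 2) ^ 2 := by nlinarith [sq_nonneg (k ^ 2)]
      nlinarith
    have h5 : p ^ 2 * 1 ≤ p ^ 2 * ((1 - k ^ 2) ^ 2 * (1 + ε / 8)) :=
      mul_le_mul_of_nonneg_left hD (sq_nonneg p)
    rw [← mul_assoc, hE] at h5
    have h6 : 0 ≤ ε ^ 3 := by positivity
    nlinarith [mul_le_mul_of_nonneg_left ha2 h6]
  have hz : |ε * ζ| ≤ 1 := by
    rw [abs_mul, abs_of_nonneg h0]
    nlinarith [abs_nonneg ζ]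
  have hε2 : 0 ≤ ε ^ 2 := by positivity
  have hε3 : 0 ≤ ε ^ 3 := by positivity
  have := sqrt_one_add_le hz
  have e2 := mul_le_mul_of_nonneg_left hsq hε2
  have e3 := mul_le_mul_of_nonneg_left hcube hε3
  -- The cubic errors are 560/8 from the square, 4913/16 from the cube and 1 from p²/2, less than
  -- 400 in total.
  nlinarith

/-- Factoring ε out of q''/q leaves a ζ that remains bounded as ε → 0; clearing its denominator
gives the polynomial hypothesis of `quotient_bound` and `slope_bound`, with a = b' and b = b'' for
the bump. -/
theorem ratio_quotient {ε : ℝ} (h0 : 0 ≤ ε) (h1 : ε ≤ 1 / 100) (x : ℝ) :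
    ∃ ζ, ratio'' ε x = ε * ζ * ratio ε x ∧
      ζ * ((1 + ε * bump x) ^ 2 * (1 - ε * bump x)) =
        -2 * (8 * Real.cos (4 * x)) * (1 + ε * bump x) + 4 * ε * (2 * Real.sin (4 * x)) ^ 2 := by
  have hp := one_add_pos h0 x
  have hm := one_sub_pos h0 h1 x
  refine ⟨(-2 * (8 * Real.cos (4 * x)) * (1 + ε * bump x) + 4 * ε * (2 * Real.sin (4 * x)) ^ 2) /
    ((1 + ε * bump x) ^ 2 * (1 - ε * bump x)), ?_, div_mul_cancel₀ _ (by positivity)⟩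
  rw [ratio'', ratio]
  field_simp

theorem abs_two_sin_le (x : ℝ) : |2 * Real.sin x| ≤ 2 := by
  rw [abs_mul, abs_two]
  linarith [Real.abs_sin_le_one x]

theorem abs_eight_cos_le (x : ℝ) : |8 * Real.cos x| ≤ 8 := by
  rw [abs_mul, abs_of_pos (by norm_num : (0:ℝ) < 8)]
  linarith [Real.abs_cos_le_one x]

theorem eps_bump_nonneg {ε : ℝ} (h0 : 0 ≤ ε) (x : ℝ) : 0 ≤ ε * bump x :=
  mul_nonneg h0 (bump_nonneg x)

theorem eps_bump_le {ε : ℝ} (h0 : 0 ≤ ε) (x : ℝ) : ε * bump x ≤ ε :=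
  mul_le_of_le_one_right h0 (bump_le_one x)

theorem ratio_convex {ε : ℝ} (h0 : 0 ≤ ε) (h1 : ε ≤ 1 / 100) (x : ℝ) :
    0 < ratio'' ε x + ratio ε x := by
  obtain ⟨ζ, e1, e2⟩ := ratio_quotient h0 h1 x
  have hb := quotient_bound h0 h1 (eps_bump_nonneg h0 x) (eps_bump_le h0 x)
    (abs_two_sin_le (4 * x)) (abs_eight_cos_le (4 * x)) e2
  have hb' := abs_le.1 (abs_eight_cos_le (4 * x))
  have hlow : -17 ≤ ζ := by linarith [(abs_le.1 hb).1]
  rw [e1, ← add_one_mul]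
  exact mul_pos (by nlinarith) (ratio_pos h0 h1 x)

-- `slope_bound` for the actual profile: p = q'/q turns εζ - p² into (q'/q)', and 2a² - b²/2 becomes
-- a constant -12 plus a harmonic of mean zero.
open IsRotational in
theorem slope_ratio_le {ε : ℝ} (h0 : 0 ≤ ε) (h1 : ε ≤ 1 / 100) (x : ℝ) :
    slope (ratio ε) (ratio'' ε) x ≤ 1 +
      (ratio'' ε x * ratio ε x - ratio' ε x * ratio' ε x) / ratio ε x ^ 2 / 2 +
      ε ^ 2 * (-12 - 20 * Real.cos (8 * x)) + 400 * ε ^ 3 := by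
  obtain ⟨ζ, e1, e2⟩ := ratio_quotient h0 h1 x
  have hq := ratio_pos h0 h1 x
  have hp := one_add_pos h0 x
  have hm := one_sub_pos h0 h1 x
  have e3 : ratio' ε x / ratio ε x * ((1 + ε * bump x) * (1 - ε * bump x)) =
      -2 * (ε * (2 * Real.sin (4 * x))) := by
    rw [ratio', ratio]
    field_simp
  have := slope_bound h0 h1 (eps_bump_nonneg h0 x) (eps_bump_le h0 x)
    (abs_two_sin_le (4 * x)) (abs_eight_cos_le (4 * x)) e2 e3
  have e4 : (ratio'' ε x + ratio ε x) / ratio ε x = 1 + ε * ζ := by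
    rw [e1]
    field_simp
    ring
  have e5 : (ratio'' ε x * ratio ε x - ratio' ε x * ratio' ε x) / ratio ε x ^ 2 =
      ε * ζ - (ratio' ε x / ratio ε x) ^ 2 := by
    rw [e1]
    field_simp
  have e6 : 2 * (2 * Real.sin (4 * x)) ^ 2 - (8 * Real.cos (4 * x)) ^ 2 / 2 =
      -12 - 20 * Real.cos (8 * x) := by
    rw [show 8 * x = 2 * (4 * x) by ring, Real.cos_two_mul, mul_pow, Real.sin_sq]
    ring
  rw [IsRotational.slope, e4, e5, ← e6]
  exact this

/-! ### The rotation number of the deformed torus -/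

theorem continuous_bump : Continuous bump := by
  unfold bump
  fun_prop

theorem continuous_ratio'' {ε : ℝ} (h0 : 0 ≤ ε) : Continuous (ratio'' ε) := by
  have := continuous_bump
  unfold ratio''
  exact Continuous.div (by fun_prop) (by fun_prop) fun x => (pow_pos (one_add_pos h0 x) 3).ne'

-- Joint continuity in ε and x: with fixed ε it makes the slope integrable, with varying ε it makes
-- the rotation number continuous.
open IsRotational in
theorem continuous_slope_ratio {X : Type*} [TopologicalSpace X] {e x : X → ℝ} (he : Continuous e)
    (hx : Continuous x) (h0 : ∀ t, 0 ≤ e t) (h1 : ∀ t, e t ≤ 1 / 100) :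
    Continuous fun t => slope (ratio (e t)) (ratio'' (e t)) (x t) := by
  have hb : Continuous fun t => bump (x t) := continuous_bump.comp hx
  have hr : Continuous fun t => ratio (e t) (x t) := by
    unfold ratio
    exact Continuous.div (by fun_prop) (by fun_prop) fun t => (one_add_pos (h0 t) (x t)).ne'
  have hr2 : Continuous fun t => ratio'' (e t) (x t) := by
    unfold ratio''
    exact Continuous.div (by fun_prop) (by fun_prop)
      fun t => (pow_pos (one_add_pos (h0 t) (x t)) 3).ne'
  exact ((hr2.add hr).div hr fun t => (ratio_pos (h0 t) (h1 t) (x t)).ne').sqrt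

-- Over a period the terms q'/(2q) and sin 8x cancel at the endpoints, leaving a rise of at most
-- 2π(1 - 12ε² + 400ε³), which is below 2π since 400ε ≤ 4.
open IsRotational in
theorem height_ratio_lt {ε : ℝ} (h0 : 0 < ε) (h1 : ε ≤ 1 / 100) :
    height (ratio ε) (ratio'' ε) (2 * Real.pi) < 2 * Real.pi := by
  have hcs : Continuous (slope (ratio ε) (ratio'' ε)) :=
    continuous_slope_ratio continuous_const continuous_id (fun _ => h0.le) fun _ => h1
  have hd : ∀ x, HasDerivAt (fun x => x + ratio' ε x / ratio ε x / 2 +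
      ε ^ 2 * (-12 * x - 20 * (Real.sin (8 * x) / 8)) + 400 * ε ^ 3 * x -
      height (ratio ε) (ratio'' ε) x) (1 +
      (ratio'' ε x * ratio ε x - ratio' ε x * ratio' ε x) / ratio ε x ^ 2 / 2 +
      ε ^ 2 * (-12 - 20 * Real.cos (8 * x)) + 400 * ε ^ 3 - slope (ratio ε) (ratio'' ε) x) x := by
    intro x
    have d1 := ((hasDerivAt_ratio' h0.le x).fun_div (hasDerivAt_ratio h0.le x)
      (ratio_pos h0.le h1 x).ne').div_const 2
    have d2 : HasDerivAt (fun x => ε ^ 2 * (-12 * x - 20 * (Real.sin (8 * x) / 8)))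
        (ε ^ 2 * (-12 - 20 * Real.cos (8 * x))) x := by
      refine ((((hasDerivAt_id x).const_mul (-12)).fun_sub
        (((((hasDerivAt_id x).const_mul 8).sin).div_const 8).const_mul 20)).const_mul
          (ε ^ 2)).congr_deriv ?_
      simp
    have d3 : HasDerivAt (fun x => 400 * ε ^ 3 * x) (400 * ε ^ 3) x := by
      simpa using (hasDerivAt_id x).const_mul (400 * ε ^ 3)
    have d4 : HasDerivAt (height (ratio ε) (ratio'' ε)) (slope (ratio ε) (ratio'' ε) x) x :=
      intervalIntegral.integral_hasDerivAt_right (hcs.intervalIntegrable _ _)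
        (hcs.stronglyMeasurableAtFilter _ _) hcs.continuousAt
    exact ((((hasDerivAt_id x).fun_add d1).fun_add d2).fun_add d3).fun_sub d4
  have hmono := monotone_of_hasDerivAt_nonneg hd fun x => sub_nonneg.2 (slope_ratio_le h0.le h1 x)
  have h2 := hmono Real.two_pi_pos.le
  have s1 : Real.sin (8 * (2 * Real.pi)) = 0 := by
    rw [show 8 * (2 * Real.pi) = (16 : ℕ) * Real.pi by push_cast; ring]
    exact Real.sin_nat_mul_pi 16
  have s2 : ratio' ε (2 * Real.pi) = 0 := by
    have : Real.sin (4 * (2 * Real.pi)) = 0 := by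
      rw [show 4 * (2 * Real.pi) = (8 : ℕ) * Real.pi by push_cast; ring]
      exact Real.sin_nat_mul_pi 8
    simp [ratio', this]
  have s3 : ratio' ε 0 = 0 := by simp [ratio']
  have s4 : height (ratio ε) (ratio'' ε) 0 = 0 := by simp [height]
  simp only [s1, s2, s3, s4, mul_zero, Real.sin_zero, zero_div, sub_zero, add_zero] at h2
  have hε : 0 < ε ^ 2 := by positivity
  have h3 : 0 < ε ^ 2 * (12 - 400 * ε) * (2 * Real.pi) :=
    mul_pos (mul_pos hε (by linarith)) Real.two_pi_pos
  linarith

open IsRotational in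
theorem height_ratio_zero : height (ratio 0) (ratio'' 0) (2 * Real.pi) = 2 * Real.pi := by
  simp [height, IsRotational.slope, ratio, ratio'']

open IsRotational in
/-- Arbitrarily small deformations have an irrational rotation number. -/
theorem exists_irrational_rotation {δ : ℝ} (hδ : 0 < δ) :
    ∃ ε ρ : ℝ, 0 < ε ∧ ε < δ ∧ ε ≤ 1 / 100 ∧ Irrational ρ ∧
      height (ratio ε) (ratio'' ε) (2 * Real.pi) = 2 * Real.pi * ρ := by
  set ε₁ := min (δ / 2) (1 / 100)
  have hε₁ : 0 < ε₁ := lt_min (by linarith) (by norm_num)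
  have hle : ε₁ ≤ 1 / 100 := min_le_right _ _
  have hcont : ContinuousOn (fun ε => height (ratio ε) (ratio'' ε) (2 * Real.pi))
      (Set.Icc 0 ε₁) := by
    rw [continuousOn_iff_continuous_domRestrict]
    exact intervalIntegral.continuous_parametric_intervalIntegral_of_continuous'
      (f := fun (ε : Set.Icc 0 ε₁) x => slope (ratio ε) (ratio'' ε) x)
      (continuous_slope_ratio (continuous_subtype_val.comp continuous_fst) continuous_snd
        (fun t => t.1.2.1) fun t => t.1.2.2.trans hle) 0 (2 * Real.pi)
  have hlt := height_ratio_lt hε₁ hle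
  -- The rotation number is 1 at ε = 0 and less than 1 at ε₁, so it attains an irrational ρ in
  -- between; ρ < 1 then excludes ε = 0.
  obtain ⟨ρ, hρ, hρ1, hρ2⟩ := exists_irrational_btwn
    ((div_lt_one Real.two_pi_pos).2 hlt)
  obtain ⟨ε, hε, hh⟩ := intermediate_value_Icc' hε₁.le hcont
    (show 2 * Real.pi * ρ ∈ _ from ⟨((div_lt_iff₀' Real.two_pi_pos).1 hρ1).le,
      by rw [height_ratio_zero]; nlinarith [Real.two_pi_pos]⟩)
  refine ⟨ε, ρ, lt_of_le_of_ne hε.1 ?_, ?_, hε.2.trans hle, hρ, hh⟩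
  · rintro rfl
    have h3 : 2 * Real.pi = 2 * Real.pi * ρ := height_ratio_zero.symm.trans hh
    nlinarith [Real.two_pi_pos]
  · exact (hε.2.trans (min_le_left _ _)).trans_lt (by linarith)

end Clifford

/-! ### The deformed torus as a smooth embedding -/

namespace Clifford

theorem finrank_E4 : Fact (Module.finrank ℝ E4 = 3 + 1) :=
  ⟨finrank_euclideanSpace_fin⟩

/-- The deformed Clifford torus as a function of `(e^{ix}, e^{iy}) ∈ ℂ²`. -/
def deformVec (ε : ℝ) (z : ℂ × ℂ) : E4 :=
  -- On the circle 2 Re z Im z = sin 2x, so its square is the bump; this makes the map the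
  -- restriction of a smooth map on ℂ².
  (√(2 * (1 + (ε * (2 * z.1.re * z.1.im) ^ 2) ^ 2)))⁻¹ •
    !₂[(1 + ε * (2 * z.1.re * z.1.im) ^ 2) * z.1.re, (1 + ε * (2 * z.1.re * z.1.im) ^ 2) * z.1.im,
      (1 - ε * (2 * z.1.re * z.1.im) ^ 2) * z.2.re, (1 - ε * (2 * z.1.re * z.1.im) ^ 2) * z.2.im]

theorem contDiff_deformVec (ε : ℝ) : ContDiff ℝ ∞ (deformVec ε) := by
  have h1 : ContDiff ℝ ∞ (fun z : ℂ × ℂ => z.1.re) := Complex.reCLM.contDiff.comp contDiff_fst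
  have h2 : ContDiff ℝ ∞ (fun z : ℂ × ℂ => z.1.im) := Complex.imCLM.contDiff.comp contDiff_fst
  have h3 : ContDiff ℝ ∞ (fun z : ℂ × ℂ => z.2.re) := Complex.reCLM.contDiff.comp contDiff_snd
  have h4 : ContDiff ℝ ∞ (fun z : ℂ × ℂ => z.2.im) := Complex.imCLM.contDiff.comp contDiff_snd
  unfold deformVec
  have hs : ContDiff ℝ ∞ (fun z : ℂ × ℂ =>
      (√(2 * (1 + (ε * (2 * z.1.re * z.1.im) ^ 2) ^ 2)))⁻¹) := by
    refine ContDiff.inv (ContDiff.sqrt (by fun_prop) fun z => by positivity) fun z => ?_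
    positivity
  refine hs.smul ?_
  rw [contDiff_euclidean]
  intro i
  fin_cases i <;> simp <;> fun_prop

theorem re_sq_add_im_sq (a : Circle) : (a : ℂ).re ^ 2 + (a : ℂ).im ^ 2 = 1 := by
  have := Circle.normSq_coe a
  rw [Complex.normSq_apply] at this
  linarith

theorem norm_deformVec (ε : ℝ) (p : Torus) : ‖deformVec ε (p.1, p.2)‖ = 1 := by
  have h1 := re_sq_add_im_sq p.1
  have h2 := re_sq_add_im_sq p.2
  rw [deformVec, norm_smul, EuclideanSpace.norm_eq, norm_inv, Real.norm_of_nonneg (by positivity),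
    inv_mul_eq_one₀ (by positivity)]
  congr 1
  simp [Fin.sum_univ_four]
  generalize (p.1 : ℂ).re = a at *
  generalize (p.1 : ℂ).im = b at *
  generalize (p.2 : ℂ).re = c at *
  generalize (p.2 : ℂ).im = d at *
  linear_combination (-(1 + ε * (2 * a * b) ^ 2) ^ 2) * h1 - (1 - ε * (2 * a * b) ^ 2) ^ 2 * h2

/-- The deformed Clifford torus. -/
def deformed (ε : ℝ) : Torus → S3 :=
  Set.codRestrict (fun p : Torus => deformVec ε (p.1, p.2)) (Metric.sphere (0 : E4) 1)
    fun p => by simp [norm_deformVec]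

theorem contMDiff_circle_coe : ContMDiff (𝓡 1) 𝓘(ℝ, ℂ) ∞ (fun a : Circle => (a : ℂ)) :=
  haveI := finrank_real_complex_fact'
  contMDiff_coe_sphere (E := ℂ) (n := 1)

theorem contMDiff_deformed (ε : ℝ) :
    ContMDiff ((𝓡 1).prod (𝓡 1)) (𝓡 3) ∞ (deformed ε) := by
  have := finrank_E4
  apply ContMDiff.codRestrict_sphere
  exact (contDiff_deformVec ε).contMDiff.comp
    ((contMDiff_circle_coe.comp contMDiff_fst).prodMk_space
      (contMDiff_circle_coe.comp contMDiff_snd))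

/-- The direction in `ℂ` of the `i`-th and `j`-th coordinates. -/
def planeDir (i j : Fin 4) (w : E4) : ℂ :=
  (‖(w i : ℂ) + w j * Complex.I‖ : ℂ)⁻¹ * ((w i : ℂ) + w j * Complex.I)

theorem differentiableAt_planeDir {i j : Fin 4} {w : E4} (hw : (w i : ℂ) + w j * Complex.I ≠ 0) :
    DifferentiableAt ℝ (planeDir i j) w := by
  have hc : ∀ i : Fin 4, DifferentiableAt ℝ (fun w : E4 => (w i : ℂ)) w := fun i =>
    Complex.ofRealCLM.differentiableAt.comp w
      (EuclideanSpace.proj i : E4 →L[ℝ] ℝ).differentiableAt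
  have hX : DifferentiableAt ℝ (fun w : E4 => (w i : ℂ) + w j * Complex.I) w :=
    (hc i).add ((hc j).mul_const _)
  have hN : DifferentiableAt ℝ (fun w : E4 => ((‖(w i : ℂ) + w j * Complex.I‖ : ℝ) : ℂ)) w :=
    Complex.ofRealCLM.differentiableAt.comp w (hX.norm ℝ hw)
  exact (hN.inv (by simpa using hw)).mul hX

theorem plane_left {ε : ℝ} (p : Torus) :
    ((deformed ε p : E4) 0 : ℂ) + (deformed ε p : E4) 1 * Complex.I =
      ((√(2 * (1 + (ε * (2 * (p.1 : ℂ).re * (p.1 : ℂ).im) ^ 2) ^ 2)))⁻¹ *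
        (1 + ε * (2 * (p.1 : ℂ).re * (p.1 : ℂ).im) ^ 2) : ℝ) * (p.1 : ℂ) := by
  apply Complex.ext <;> simp [deformed, deformVec] <;> ring

theorem plane_right {ε : ℝ} (p : Torus) :
    ((deformed ε p : E4) 2 : ℂ) + (deformed ε p : E4) 3 * Complex.I =
      ((√(2 * (1 + (ε * (2 * (p.1 : ℂ).re * (p.1 : ℂ).im) ^ 2) ^ 2)))⁻¹ *
        (1 - ε * (2 * (p.1 : ℂ).re * (p.1 : ℂ).im) ^ 2) : ℝ) * (p.2 : ℂ) := by
  apply Complex.ext <;> simp [deformed, deformVec] <;> ring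

theorem two_re_mul_im_sq_le (a : Circle) : (2 * (a : ℂ).re * (a : ℂ).im) ^ 2 ≤ 1 := by
  have h := re_sq_add_im_sq a
  nlinarith [sq_nonneg ((a : ℂ).re ^ 2 - (a : ℂ).im ^ 2)]

/-- Normalizing a positive multiple of a unit complex number returns that number. Applied to the two
coordinate planes, this recovers both circle factors from the image point by maps differentiable
there. -/
theorem planeDir_of_eq {i j : Fin 4} {w : E4} {l : ℝ} {a : Circle} (hl : 0 < l)
    (h : (w i : ℂ) + w j * Complex.I = l * (a : ℂ)) :
    DifferentiableAt ℝ (planeDir i j) w ∧ planeDir i j w = a := by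
  have hl' : (l : ℂ) ≠ 0 := by exact_mod_cast hl.ne'
  refine ⟨differentiableAt_planeDir (h ▸ mul_ne_zero hl' a.coe_ne_zero), ?_⟩
  rw [planeDir, h, norm_mul, Circle.norm_coe, mul_one, Complex.norm_real,
    Real.norm_of_nonneg hl.le, inv_mul_cancel_left₀ hl']

theorem planeDir_left {ε : ℝ} (h0 : 0 ≤ ε) (p : Torus) :
    DifferentiableAt ℝ (planeDir 0 1) (deformed ε p : E4) ∧ planeDir 0 1 (deformed ε p) = p.1 :=
  planeDir_of_eq (mul_pos (by positivity)
    (add_pos_of_pos_of_nonneg one_pos (mul_nonneg h0 (sq_nonneg _)))) (plane_left p)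

theorem planeDir_right {ε : ℝ} (h0 : 0 ≤ ε) (h1 : ε ≤ 1 / 100) (p : Torus) :
    DifferentiableAt ℝ (planeDir 2 3) (deformed ε p : E4) ∧ planeDir 2 3 (deformed ε p) = p.2 := by
  refine planeDir_of_eq ?_ (plane_right p)
  have := two_re_mul_im_sq_le p.1
  have h2 := sq_nonneg (2 * (p.1 : ℂ).re * (p.1 : ℂ).im)
  exact mul_pos (by positivity) (by nlinarith)

theorem mfderiv_circle_coe_injective (a : Circle) :
    Function.Injective (mfderiv (𝓡 1) 𝓘(ℝ, ℂ) (fun a : Circle => (a : ℂ)) a) :=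
  haveI := finrank_real_complex_fact'
  injective_mvfderiv_subtypeVal_sphere (E := ℂ) (n := 1) a

/-- If `g ∘ α = f` for the deformed torus `α`, then the differential of `α` separates the tangent
vectors that the differential of `f` separates. -/
theorem mfderiv_eq_of_comp_eq {ε : ℝ} {g : E4 → ℂ} {f : Torus → ℂ} {p : Torus}
    (hg : DifferentiableAt ℝ g (deformed ε p : E4)) (hf : ∀ p, g (deformed ε p) = f p)
    {v w : TangentSpace ((𝓡 1).prod (𝓡 1)) p}
    (h : mfderiv ((𝓡 1).prod (𝓡 1)) (𝓡 3) (deformed ε) p v =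
      mfderiv ((𝓡 1).prod (𝓡 1)) (𝓡 3) (deformed ε) p w) :
    mfderiv ((𝓡 1).prod (𝓡 1)) 𝓘(ℝ, ℂ) f p v = mfderiv ((𝓡 1).prod (𝓡 1)) 𝓘(ℝ, ℂ) f p w := by
  have := finrank_E4
  have hα : MDifferentiableAt ((𝓡 1).prod (𝓡 1)) (𝓡 3) (deformed ε) p :=
    (contMDiff_deformed ε p).mdifferentiableAt (by simp)
  have hc : MDifferentiableAt (𝓡 3) 𝓘(ℝ, E4) ((↑) : S3 → E4) (deformed ε p) :=
    (contMDiff_coe_sphere (m := ∞) (deformed ε p)).mdifferentiableAt (by simp)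
  have hgc : MDifferentiableAt (𝓡 3) 𝓘(ℝ, ℂ) (g ∘ ((↑) : S3 → E4)) (deformed ε p) :=
    hg.mdifferentiableAt.comp _ hc
  have he : f = (g ∘ ((↑) : S3 → E4)) ∘ deformed ε := funext fun p => (hf p).symm
  rw [he, mfderiv_comp_apply p hgc hα, mfderiv_comp_apply p hgc hα, h]

/-- The plane directions form a left inverse: it gives injectivity, and by the chain rule
injectivity of the differential. Compactness of the torus does the rest. -/
theorem isTorusEmbedding_deformed {ε : ℝ} (h0 : 0 ≤ ε) (h1 : ε ≤ 1 / 100) :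
    IsTorusEmbedding (deformed ε) := by
  refine ⟨contMDiff_deformed ε, fun p v w h => ?_, ?_⟩
  · have e1 := mfderiv_eq_of_comp_eq (f := (fun a : Circle => (a : ℂ)) ∘ Prod.fst)
      (planeDir_left h0 p).1 (fun p => (planeDir_left h0 p).2) h
    have e2 := mfderiv_eq_of_comp_eq (f := (fun a : Circle => (a : ℂ)) ∘ Prod.snd)
      (planeDir_right h0 h1 p).1 (fun p => (planeDir_right h0 h1 p).2) h
    have hc : ∀ a : Circle, MDifferentiableAt (𝓡 1) 𝓘(ℝ, ℂ) (fun a : Circle => (a : ℂ)) a := fun a =>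
      (contMDiff_circle_coe a).mdifferentiableAt (by simp)
    rw [mfderiv_comp_apply p (hc p.1) mdifferentiableAt_fst,
      mfderiv_comp_apply p (hc p.1) mdifferentiableAt_fst, mfderiv_fst] at e1
    rw [mfderiv_comp_apply p (hc p.2) mdifferentiableAt_snd,
      mfderiv_comp_apply p (hc p.2) mdifferentiableAt_snd, mfderiv_snd] at e2
    exact Prod.ext (mfderiv_circle_coe_injective _ e1) (mfderiv_circle_coe_injective _ e2)
  · refine ((contMDiff_deformed ε).continuous.isClosedEmbedding fun p p' h => ?_).isEmbedding
    refine Prod.ext (Circle.ext ?_) (Circle.ext ?_)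
    · rw [← (planeDir_left h0 p).2, h, (planeDir_left h0 p').2]
    · rw [← (planeDir_right h0 h1 p).2, h, (planeDir_right h0 h1 p').2]

/-! ### The deformed torus in angular coordinates -/

/-- The radius of the first circle. -/
def radius (ε x : ℝ) : ℝ := (1 + ε * bump x) * (√(2 * (1 + (ε * bump x) ^ 2)))⁻¹

theorem contDiff_radius (ε : ℝ) : ContDiff ℝ ∞ (radius ε) := by
  unfold radius bump
  refine ContDiff.mul (by fun_prop) ?_
  refine ContDiff.inv (ContDiff.sqrt (by fun_prop) fun z => by positivity) fun z => ?_
  positivity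

theorem deformed_cover (ε x y : ℝ) : (deformed ε (cover (x, y)) : E4) =
    (√(2 * (1 + (ε * bump x) ^ 2)))⁻¹ • !₂[(1 + ε * bump x) * Real.cos x,
      (1 + ε * bump x) * Real.sin x, (1 - ε * bump x) * Real.cos y,
      (1 - ε * bump x) * Real.sin y] := by
  have hb : (2 * Real.cos x * Real.sin x) ^ 2 = bump x := by
    rw [bump, Real.sin_two_mul]
    ring
  simp [deformed, deformVec, cover, Circle.coe_exp, Complex.exp_ofReal_mul_I_re,
    Complex.exp_ofReal_mul_I_im, hb]

theorem periodic_bump : Function.Periodic bump (2 * Real.pi) := fun x => by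
  rw [bump, bump, show 2 * (x + 2 * Real.pi) = 2 * x + (2 : ℕ) * (2 * Real.pi) by push_cast; ring,
    Real.sin_add_nat_mul_two_pi]

theorem sin_four_periodic (x : ℝ) : Real.sin (4 * (x + 2 * Real.pi)) = Real.sin (4 * x) := by
  rw [show 4 * (x + 2 * Real.pi) = 4 * x + (4 : ℕ) * (2 * Real.pi) by push_cast; ring,
    Real.sin_add_nat_mul_two_pi]

theorem cos_four_periodic (x : ℝ) : Real.cos (4 * (x + 2 * Real.pi)) = Real.cos (4 * x) := by
  rw [show 4 * (x + 2 * Real.pi) = 4 * x + (4 : ℕ) * (2 * Real.pi) by push_cast; ring,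
    Real.cos_add_nat_mul_two_pi]

theorem periodic_radius (ε : ℝ) : Function.Periodic (radius ε) (2 * Real.pi) := fun x => by
  simp only [radius, periodic_bump x]

theorem isRotational_deformed {ε : ℝ} (h0 : 0 ≤ ε) (h1 : ε ≤ 1 / 100) :
    IsRotational (deformed ε) (radius ε) (deriv (radius ε)) (deriv (deriv (radius ε)))
      (ratio ε) (ratio' ε) (ratio'' ε) where
  coord_eq x y := by
    have := (one_add_pos h0 x).ne'
    rw [TorusMap.coord, deformed_cover, ratio, radius]
    ext i
    fin_cases i <;> simp <;> field_simp
  hr x := ((contDiff_radius ε).differentiable (by simp) x).hasDerivAt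
  hr1 x := by
    have : ContDiff ℝ 2 (radius ε) := contDiff_infty.1 (contDiff_radius ε) 2
    exact ((contDiff_succ_iff_deriv (n := 1)).1 this).2.2.differentiable (by simp) x |>.hasDerivAt
  hq := hasDerivAt_ratio h0
  hq1 := hasDerivAt_ratio' h0
  r_pos x := mul_pos (one_add_pos h0 x) (by positivity)
  q_pos := ratio_pos h0 h1
  convex := ratio_convex h0 h1
  continuous_q2 := continuous_ratio'' h0
  periodic_r := periodic_radius ε
  periodic_r1 x := by
    rw [← deriv_comp_add_const, (periodic_radius ε).funext]
  periodic_q x := by simp only [ratio, periodic_bump x]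
  periodic_q1 x := by simp only [ratio', periodic_bump x, sin_four_periodic]
  periodic_q2 x := by simp only [ratio'', periodic_bump x, sin_four_periodic, cos_four_periodic]

/-- C and N are orthonormal, so |C + εhN| = √(1 + (εh)²); together with the factor √2/2 this is the
normalization in `deformVec`. -/
theorem deformed_eq_deformation (ε u v : ℝ) :
    (deformed ε (cover (-u + v, u + v)) : E4) = deformation ε u v := by
  have hh : h u v = bump (-u + v) := by
    rw [h, bump, show 2 * v - 2 * u = 2 * (-u + v) by ring]
  have hv : C u v + (ε * h u v) • N u v = (√2 / 2) • !₂[(1 + ε * h u v) * Real.cos (-u + v),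
      (1 + ε * h u v) * Real.sin (-u + v), (1 - ε * h u v) * Real.cos (u + v),
      (1 - ε * h u v) * Real.sin (u + v)] := by
    ext i
    fin_cases i <;> simp [C, N] <;> ring
  have hn : ‖C u v + (ε * h u v) • N u v‖ = √(1 + (ε * h u v) ^ 2) := by
    rw [hv, norm_smul, EuclideanSpace.norm_eq, Real.norm_of_nonneg (by positivity)]
    rw [show √2 / 2 = √(1 / 2) by
      rw [Real.sqrt_div zero_le_one, Real.sqrt_one, Real.sqrt_div_self']]
    rw [← Real.sqrt_mul (by norm_num)]
    congr 1
    simp [Fin.sum_univ_four]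
    linear_combination ((1 + ε * h u v) ^ 2 / 2) * Real.sin_sq_add_cos_sq (-u + v) +
      ((1 - ε * h u v) ^ 2 / 2) * Real.sin_sq_add_cos_sq (u + v)
  rw [deformation, hn, hv, deformed_cover, hh, smul_smul]
  congr 1
  rw [Real.sqrt_mul (by norm_num), mul_inv, mul_comm, Real.sqrt_div_self]

end Clifford

end

theorem theorem1 (δ : ℝ) (hδ : 0 < δ) :
    ∃ ε : ℝ, ε ≠ 0 ∧ |ε| < δ ∧ ∃ α : Torus → S3,
      IsTorusEmbedding α ∧
      (∀ u v : ℝ, (α (cover (-u + v, u + v)) : E4) = Clifford.deformation ε u v) ∧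
      (∀ q : ℝ × ℝ, TorusMap.IsHyperbolic α q) ∧
      ∀ i : Fin 2,
        (∀ p : Torus, ∃ c : ℝ → ℝ × ℝ, TorusMap.IsAsymptoticLine α i c ∧ cover (c 0) = p) ∧
        ∀ c : ℝ → ℝ × ℝ, TorusMap.IsAsymptoticLine α i c →
          Dense (Set.range (cover ∘ c)) ∧ TorusMap.limitSet (cover ∘ c) = Set.univ := by
  obtain ⟨ε, ρ, h0, hlt, h1, hρ, hht⟩ := Clifford.exists_irrational_rotation hδ
  have H := Clifford.isRotational_deformed h0.le h1
  refine ⟨ε, h0.ne', by rwa [abs_of_pos h0], Clifford.deformed ε,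
    Clifford.isTorusEmbedding_deformed h0.le h1, Clifford.deformed_eq_deformation ε,
    H.isHyperbolic, fun i => ⟨H.exists_isAsymptoticLine i, fun c hc => ?_⟩⟩
  have hL := H.limitSet_eq_univ hρ hht hc
  exact ⟨IsRotational.dense_of_limitSet_eq_univ hL, hL⟩
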